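/- Call a $2$-dimensional convex polytope in $\mathbb{R}^2$ a polygon, and call it a lattice polygon if all of its vertices belong to $\mathbb{Z}^2$. Let $P$ be a polygon with vertex set $\mathcal{V}$. A point $x\in\mathbb{R}^2\setminus P$ can be inserted in $P$ if the vertex set of the convex hull of $P\cup\{x\}$ is exactly $\mathcal{V}\cup\{x\}$; the insertion move then replaces $P$ by this convex hull. A vertex $v\in\mathcal{V}$ can be deleted from $P$ if the convex hull of $\mathcal{V}\setminus\{v\}$ is $2$-dimensional; the deletion move then replaces $P$ by this convex hull. Let $\Lambda(2)$ be the graph whose vertices are the lattice polygons and whose edges connect any two lattice polygons that can be obtained from one another by an insertion move or a deletion move. Theorem. The subgraph induced in $\Lambda(2)$ by the lattice polygons with exactly five or exactly six vertices (the lattice pentagons and the lattice hexagons) is connected. -/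

import Mathlib

/-- The `d`-dimensional polytopes contained in `ℝ^d`: convex hulls of finite sets of points whose
affine hull is the whole space. -/
structure FullPolytope (d : ℕ) where
  /-- The underlying set of points. -/
  carrier : Set (EuclideanSpace ℝ (Fin d))
  isPolytope : ∃ S : Finset (EuclideanSpace ℝ (Fin d)),
    carrier = convexHull ℝ (S : Set (EuclideanSpace ℝ (Fin d)))
  fullDim : affineSpan ℝ carrier = ⊤

namespace FullPolytope

variable {d : ℕ}

/-- The vertex set of a polytope (its extreme points). -/
def vertices (P : FullPolytope d) : Set (EuclideanSpace ℝ (Fin d)) :=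
  P.carrier.extremePoints ℝ

/-- The point `x`, which lies outside of `P`, can be inserted in `P`: the convex hull of
`P ∪ {x}` has the vertices of `P` and the point `x` as its vertex set. -/
def CanInsert (P : FullPolytope d) (x : EuclideanSpace ℝ (Fin d)) : Prop :=
  x ∉ P.carrier ∧ (convexHull ℝ (P.carrier ∪ {x})).extremePoints ℝ = P.vertices ∪ {x}

/-- The vertex `v` can be deleted from `P`: the convex hull of the other vertices is still
`d`-dimensional. -/
def CanDelete (P : FullPolytope d) (v : EuclideanSpace ℝ (Fin d)) : Prop :=
  v ∈ P.vertices ∧ affineSpan ℝ (convexHull ℝ (P.vertices \ {v})) = ⊤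

/-- `Q` is obtained from `P` by an insertion move. -/
def InsertionMove (P Q : FullPolytope d) : Prop :=
  ∃ x, P.CanInsert x ∧ Q.carrier = convexHull ℝ (P.carrier ∪ {x})

/-- `Q` is obtained from `P` by a deletion move. -/
def DeletionMove (P Q : FullPolytope d) : Prop :=
  ∃ v, P.CanDelete v ∧ Q.carrier = convexHull ℝ (P.vertices \ {v})

/-- A lattice polytope: all the vertices belong to `ℤ^d`. -/
def IsLattice (P : FullPolytope d) : Prop :=
  ∀ v ∈ P.vertices, ∀ i, ∃ z : ℤ, v i = (z : ℝ)

end FullPolytope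

/-- The graph `Γ(d)` on all `d`-dimensional polytopes in `ℝ^d`: two distinct polytopes are adjacent
when one is obtained from the other by an insertion move or a deletion move. -/
def polytopeGraph (d : ℕ) : SimpleGraph (FullPolytope d) :=
  SimpleGraph.fromRel fun P Q => P.InsertionMove Q ∨ P.DeletionMove Q

/-- The graph `Λ(d)`: the subgraph induced in `Γ(d)` by the lattice polytopes. -/
def latticePolytopeGraph (d : ℕ) : SimpleGraph {P : FullPolytope d // P.IsLattice} :=
  (polytopeGraph d).induce {P : FullPolytope d | P.IsLattice}

/-!
Call a finite set of lattice points a convex chain if it stays in convex position when some point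
at infinity is added. Two chains with the same point at infinity are connected by exchanging their
vertices, one at a time, for far away points of a parabola whose axis has that direction. One side
of a parabola is a chain both for the axis and for the tangent at the apex, so all chains are
connected with each other.

A pentagon with two diverging edges next to a common edge is a chain. If two such edges are
parallel, moving one vertex makes a pair of edges diverge. Otherwise, if two consecutive ears have
different areas, one of the vertices can be exchanged for the fourth vertex of a parallelogram so
that a pair of edges diverges. If all the ears had the same area, the pentagon would be an affine
image of the regular one, which is not a lattice pentagon because the golden ratio is irrational.
-/

/-! ### Convexly independent sets -/

section Convexity

variable {E : Type*} [AddCommGroup E] [Module ℝ E]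

theorem not_collinear_of_convexIndependent {A : Set E} (hA : ConvexIndependent ℝ ((↑) : A → E))
    {a b c : E} (ha : a ∈ A) (hb : b ∈ A) (hc : c ∈ A) (hab : a ≠ b) (hac : a ≠ c) (hbc : b ≠ c) :
    ¬ Collinear ℝ {a, b, c} := by
  have not_wbtw {x y z : E} (hx : x ∈ A) (hy : y ∈ A) (hz : z ∈ A) (hxy : x ≠ y) (hzy : z ≠ y) :
      ¬ Wbtw ℝ x y z := by
    rw [← mem_segment_iff_wbtw, ← convexHull_pair]
    have hsub : {x, z} ⊆ A \ {y} := Set.pair_subset ⟨hx, hxy⟩ ⟨hz, hzy⟩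
    exact fun h =>
      convexIndependent_set_iff_notMem_convexHull_sdiff.1 hA y hy (convexHull_mono hsub h)
  intro h
  rcases h.wbtw_or_wbtw_or_wbtw with h | h | h
  · exact not_wbtw ha hb hc hab hbc.symm h
  · exact not_wbtw hb hc ha hbc hac h
  · exact not_wbtw hc ha hb hac.symm hab.symm h

theorem affineSpan_eq_top_of_convexIndependent {A : Set E} (hE : Module.finrank ℝ E = 2)
    (hA : ConvexIndependent ℝ ((↑) : A → E)) (hcard : 2 < A.ncard) : affineSpan ℝ A = ⊤ := by
  have : FiniteDimensional ℝ E := .of_finrank_pos (by omega)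
  obtain ⟨a, b, c, ha, hb, hc, hab, hac, hbc⟩ :=
    (Set.two_lt_ncard_iff (Set.finite_of_ncard_pos (by omega))).1 hcard
  have hcol : ¬ Collinear ℝ {a, b, c} :=
    not_collinear_of_convexIndependent hA ha hb hc hab hac hbc
  have hspan := (affineIndependent_iff_not_collinear_set.2 hcol)
    |>.affineSpan_eq_top_iff_card_eq_finrank_add_one.2 (by simp [hE])
  refine top_unique (hspan ▸ affineSpan_mono ℝ ?_)
  rintro _ ⟨i, rfl⟩
  fin_cases i
  exacts [ha, hb, hc]

theorem convexIndependent_of_exists_forall_lt {A : Set E}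
    (h : ∀ x ∈ A, ∃ f : E →ₗ[ℝ] ℝ, ∀ y ∈ A, y ≠ x → f x < f y) :
    ConvexIndependent ℝ ((↑) : A → E) := by
  refine convexIndependent_set_iff_notMem_convexHull_sdiff.2 fun x hx hmem => ?_
  obtain ⟨f, hf⟩ := h x hx
  have hsub : convexHull ℝ (A \ {x}) ⊆ {y | f x < f y} :=
    convexHull_min (fun y hy => hf y hy.1 hy.2) (convex_halfSpace_gt f.isLinear _)
  exact lt_irrefl (f x) (hsub hmem)

variable [TopologicalSpace E] [IsTopologicalAddGroup E] [ContinuousSMul ℝ E]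
  [LocallyConvexSpace ℝ E] [T2Space E]

theorem exists_forall_lt_of_convexIndependent {A : Set E} (hfin : A.Finite)
    (hA : ConvexIndependent ℝ ((↑) : A → E)) {x : E} (hx : x ∈ A) :
    ∃ f : StrongDual ℝ E, ∀ y ∈ A, y ≠ x → f x < f y := by
  have hclosed : IsClosed (convexHull ℝ (A \ {x})) :=
    ((hfin.subset Set.sdiff_subset).isCompact_convexHull ℝ).isClosed
  obtain ⟨f, r, hfx, hf⟩ := geometric_hahn_banach_point_closed (convex_convexHull ℝ _) hclosed
    (convexIndependent_set_iff_notMem_convexHull_sdiff.1 hA x hx)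
  exact ⟨f, fun y hy hne => hfx.trans (hf y (subset_convexHull ℝ _ ⟨hy, hne⟩))⟩

theorem convexHull_extremePoints_convexHull {A : Set E} (hfin : A.Finite) :
    convexHull ℝ ((convexHull ℝ A).extremePoints ℝ) = convexHull ℝ A := by
  have hclosed : IsClosed (convexHull ℝ ((convexHull ℝ A).extremePoints ℝ)) :=
    ((hfin.subset extremePoints_convexHull_subset).isCompact_convexHull ℝ).isClosed
  rw [← hclosed.closure_eq]
  exact closure_convexHull_extremePoints (hfin.isCompact_convexHull ℝ) (convex_convexHull ℝ A)

theorem extremePoints_convexHull_of_convexIndependent {A : Set E} (hfin : A.Finite)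
    (hA : ConvexIndependent ℝ ((↑) : A → E)) : (convexHull ℝ A).extremePoints ℝ = A := by
  refine extremePoints_convexHull_subset.antisymm fun x hx => ?_
  refine convexIndependent_set_iff_inter_convexHull_subset.1 hA _ extremePoints_convexHull_subset
    ⟨hx, ?_⟩
  rw [convexHull_extremePoints_convexHull hfin]
  exact subset_convexHull ℝ A hx

end Convexity

namespace FullPolytope

variable {d : ℕ}

theorem vertices_finite (P : FullPolytope d) : P.vertices.Finite := by
  obtain ⟨A, hA⟩ := P.isPolytope
  rw [vertices, hA]
  exact A.finite_toSet.subset extremePoints_convexHull_subset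

theorem convexHull_vertices (P : FullPolytope d) : convexHull ℝ P.vertices = P.carrier := by
  obtain ⟨A, hA⟩ := P.isPolytope
  rw [vertices, hA]
  exact convexHull_extremePoints_convexHull A.finite_toSet

theorem convexIndependent_vertices (P : FullPolytope d) :
    ConvexIndependent ℝ ((↑) : P.vertices → EuclideanSpace ℝ (Fin d)) := by
  have hconv : Convex ℝ P.carrier := P.convexHull_vertices ▸ convex_convexHull ℝ _
  exact hconv.convexIndependent_extremePoints

theorem vertices_injective : Function.Injective (vertices (d := d)) := by
  intro P Q h
  have hcarrier : P.carrier = Q.carrier := by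
    rw [← P.convexHull_vertices, h, Q.convexHull_vertices]
  cases P
  cases Q
  congr

theorem adj_of_vertices_eq_insert {P Q : FullPolytope d} {x : EuclideanSpace ℝ (Fin d)}
    (hx : x ∉ P.vertices) (hQ : Q.vertices = insert x P.vertices) :
    (polytopeGraph d).Adj P Q := by
  have hcarrier : Q.carrier = convexHull ℝ (P.carrier ∪ {x}) := by
    rw [← Q.convexHull_vertices, ← P.convexHull_vertices, convexHull_convexHull_union_left, hQ,
      Set.union_singleton]
  have hxP : x ∉ P.carrier := by
    have hPQ : P.carrier ⊆ Q.carrier := hcarrier ▸ Set.subset_union_left.trans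
      (subset_convexHull ℝ _)
    have hxQ : x ∈ Q.vertices := hQ ▸ Set.mem_insert x _
    exact fun h => hx (inter_extremePoints_subset_extremePoints_of_subset hPQ ⟨h, hxQ⟩)
  rw [polytopeGraph, SimpleGraph.fromRel_adj]
  refine ⟨?_, .inl (.inl ⟨x, ⟨hxP, ?_⟩, hcarrier⟩)⟩
  · rintro rfl
    exact hx (hQ ▸ Set.mem_insert x _)
  · rw [← hcarrier, Set.union_singleton, ← hQ, vertices]

end FullPolytope

/-! ### Lattice points in convex position -/

section LatticePoints

variable {d : ℕ}

/-- The inclusion of `ℤ^d` in the Euclidean space `ℝ^d`. -/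
noncomputable def latticePoint (v : Fin d → ℤ) : EuclideanSpace ℝ (Fin d) :=
  WithLp.toLp 2 fun i => (v i : ℝ)

@[simp]
theorem latticePoint_apply (v : Fin d → ℤ) (i : Fin d) : latticePoint v i = v i := rfl

theorem latticePoint_injective : Function.Injective (latticePoint (d := d)) := by
  intro v w h
  ext i
  simpa using congrArg (fun x => x i) h

/-- A set of lattice points is in convex position if none of its points belongs to the convex hull
of the other ones. -/
def ConvexPosition (S : Set (Fin d → ℤ)) : Prop :=
  ConvexIndependent ℝ ((↑) : latticePoint '' S → EuclideanSpace ℝ (Fin d))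

theorem ConvexPosition.mono {S T : Set (Fin d → ℤ)} (h : ConvexPosition T) (hST : S ⊆ T) :
    ConvexPosition S :=
  ConvexIndependent.mono h (Set.image_mono hST)

theorem ConvexPosition.not_collinear {S : Set (Fin d → ℤ)} (h : ConvexPosition S)
    {a b c : Fin d → ℤ} (ha : a ∈ S) (hb : b ∈ S) (hc : c ∈ S) (hab : a ≠ b) (hac : a ≠ c)
    (hbc : b ≠ c) : ¬ Collinear ℝ {latticePoint a, latticePoint b, latticePoint c} :=
  not_collinear_of_convexIndependent h ⟨a, ha, rfl⟩ ⟨b, hb, rfl⟩ ⟨c, hc, rfl⟩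
    (latticePoint_injective.ne hab) (latticePoint_injective.ne hac) (latticePoint_injective.ne hbc)

theorem ConvexPosition.exists_inner_lt {S : Finset (Fin d → ℤ)}
    (h : ConvexPosition (S : Set (Fin d → ℤ))) {v : Fin d → ℤ} (hv : v ∈ S) :
    ∃ p : EuclideanSpace ℝ (Fin d), ∀ w ∈ S, w ≠ v →
      inner ℝ p (latticePoint v) < inner ℝ p (latticePoint w) := by
  obtain ⟨f, hf⟩ := exists_forall_lt_of_convexIndependent (S.finite_toSet.image latticePoint) h
    ⟨v, hv, rfl⟩
  refine ⟨(InnerProductSpace.toDual ℝ _).symm f, fun w hw hne => ?_⟩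
  simpa using hf _ ⟨w, hw, rfl⟩ (latticePoint_injective.ne hne)

theorem FullPolytope.IsLattice.exists_finset_vertices_eq {P : FullPolytope d} (hP : P.IsLattice) :
    ∃ S : Finset (Fin d → ℤ), ConvexPosition (S : Set (Fin d → ℤ)) ∧
      P.vertices = latticePoint '' S := by
  have hrange : P.vertices ⊆ Set.range latticePoint := by
    intro v hv
    choose z hz using hP v hv
    exact ⟨z, by ext i; exact (hz i).symm⟩
  have hS : P.vertices = latticePoint ''
      ((P.vertices_finite.preimage latticePoint_injective.injOn).toFinset : Set (Fin d → ℤ)) := by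
    rw [Set.Finite.coe_toFinset, Set.image_preimage_eq_of_subset hrange]
  exact ⟨_, by rw [ConvexPosition, ← hS]; exact P.convexIndependent_vertices, hS⟩

theorem ConvexPosition.exists_vertices_eq {S : Finset (Fin 2 → ℤ)}
    (h : ConvexPosition (S : Set (Fin 2 → ℤ))) (hcard : 2 < S.card) :
    ∃ P : FullPolytope 2, P.IsLattice ∧ P.vertices = latticePoint '' S := by
  have hvertices := extremePoints_convexHull_of_convexIndependent
    (S.finite_toSet.image latticePoint) h
  have hspan : affineSpan ℝ (convexHull ℝ (latticePoint '' (S : Set (Fin 2 → ℤ)))) = ⊤ := by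
    rw [affineSpan_convexHull]
    refine affineSpan_eq_top_of_convexIndependent (by simp) h ?_
    rwa [Set.ncard_image_of_injective _ latticePoint_injective, Set.ncard_coe_finset]
  refine ⟨⟨_, ⟨S.image latticePoint, by rw [Finset.coe_image]⟩, hspan⟩, ?_, hvertices⟩
  intro v hv i
  obtain ⟨z, -, rfl⟩ := hvertices.le hv
  exact ⟨z i, rfl⟩

end LatticePoints

/-! ### Convex polygons -/

section Orientation

variable {R : Type*} [CommRing R]

/-- The determinant of two vectors of the plane. -/
def cross (u v : Fin 2 → R) : R := u 0 * v 1 - u 1 * v 0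

/-- Twice the signed area of the triangle `abc`, positive when `a`, `b`, `c` are in counterclockwise
order. -/
def orient (a b c : Fin 2 → R) : R := cross (b - a) (c - a)

theorem cross_sub_left (u v w : Fin 2 → R) : cross (u - v) w = cross u w - cross v w := by
  simp only [cross, Pi.sub_apply]
  ring

theorem orient_rotate (a b c : Fin 2 → R) : orient b c a = orient a b c := by
  simp only [orient, cross, Pi.sub_apply]
  ring

theorem orient_swap (a b c : Fin 2 → R) : orient a c b = -orient a b c := by
  simp only [orient, cross]
  ring

theorem orient_self_left (a b : Fin 2 → R) : orient a a b = 0 := by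
  simp [orient, cross]

theorem orient_self_right (a b : Fin 2 → R) : orient a b b = 0 := by
  simp only [orient, cross]
  ring

theorem orient_mul_orient (o a b c d : Fin 2 → R) :
    orient o a c * orient o b d = orient o a b * orient o c d + orient o a d * orient o b c := by
  simp only [orient, cross]
  ring

variable [LinearOrder R]

theorem orient_pos_iff_of_pos [IsStrictOrderedRing R] {o a b c d : Fin 2 → R}
    (hab : 0 < orient o a b) (hcd : 0 < orient o c d)
    (had : 0 < orient o a d) (hbc : 0 < orient o b c) :
    0 < orient o a c ↔ 0 < orient o b d :=
  pos_iff_pos_of_mul_pos (by rw [orient_mul_orient]; positivity)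

/-- The points `v i` are the vertices of a convex polygon, listed in counterclockwise order. -/
def IsConvexPolygon {ι : Type*} [LinearOrder ι] (v : ι → Fin 2 → R) : Prop :=
  ∀ ⦃i j k⦄, i < j → j < k → 0 < orient (v i) (v j) (v k)

namespace IsConvexPolygon

theorem comp_strictMono {ι κ : Type*} [LinearOrder ι] [LinearOrder κ] {v : ι → Fin 2 → R}
    (h : IsConvexPolygon v) {f : κ → ι} (hf : StrictMono f) : IsConvexPolygon (v ∘ f) :=
  fun _ _ _ hij hjk => h (hf hij) (hf hjk)

theorem orient_pos_of_covBy {ι : Type*} [LinearOrder ι] {v : ι → Fin 2 → R}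
    (h : IsConvexPolygon v) {i j k : ι} (hij : i ⋖ j) (hki : k ≠ i) (hkj : k ≠ j) :
    0 < orient (v i) (v j) (v k) := by
  rcases hki.lt_or_gt with hki | hik
  · rw [orient_rotate]
    exact h hki hij.lt
  · exact h hij.lt ((hij.ge_of_gt hik).lt_of_ne hkj.symm)

theorem orient_nonneg_of_covBy {ι : Type*} [LinearOrder ι] {v : ι → Fin 2 → R}
    (h : IsConvexPolygon v) {i j : ι} (hij : i ⋖ j) (k : ι) : 0 ≤ orient (v i) (v j) (v k) := by
  rcases eq_or_ne k i with rfl | hki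
  · rw [orient_rotate, orient_self_left]
  rcases eq_or_ne k j with rfl | hkj
  · rw [orient_self_right]
  exact (h.orient_pos_of_covBy hij hki hkj).le

theorem rotate {n : ℕ} {v : Fin (n + 1) → Fin 2 → R} (h : IsConvexPolygon v) (i : Fin (n + 1)) :
    IsConvexPolygon fun j => v (j + i) := by
  intro a b c hab hbc
  have ha := Fin.val_add_eq_ite a i
  have hb := Fin.val_add_eq_ite b i
  have hc := Fin.val_add_eq_ite c i
  obtain ⟨hab', hbc'⟩ | ⟨hca', hab'⟩ | ⟨hbc', hca'⟩ : (a + i < b + i ∧ b + i < c + i) ∨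
      (c + i < a + i ∧ a + i < b + i) ∨ (b + i < c + i ∧ c + i < a + i) := by
    simp only [Fin.lt_def] at hab hbc ⊢
    split_ifs at ha hb hc <;> omega
  · exact h hab' hbc'
  · rw [orient_rotate]
    exact h hca' hab'
  · rw [← orient_rotate]
    exact h hbc' hca'

theorem cons {n : ℕ} {v : Fin n → Fin 2 → R} (h : IsConvexPolygon v) {a : Fin 2 → R}
    (ha : ∀ i j, i < j → 0 < orient a (v i) (v j)) :
    IsConvexPolygon (Fin.cons a v : Fin (n + 1) → Fin 2 → R) := by
  intro i j k hij hjk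
  obtain ⟨j, rfl⟩ := Fin.exists_succ_eq.2 (Fin.ne_zero_of_lt hij)
  obtain ⟨k, rfl⟩ := Fin.exists_succ_eq.2 (Fin.ne_zero_of_lt hjk)
  rw [Fin.succ_lt_succ_iff] at hjk
  cases i using Fin.cases with
  | zero => exact ha j k hjk
  | succ i => exact h (Fin.succ_lt_succ_iff.1 hij) hjk

variable [IsStrictOrderedRing R] {n : ℕ} {v : Fin (n + 3) → Fin 2 → R}

theorem orient_zero_pos_of_beyond (h : IsConvexPolygon v) {x : Fin 2 → R}
    (hlast : 0 < orient (v (Fin.last _)) x (v 0)) (hzero : 0 < orient x (v 0) (v 1))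
    {j : Fin (n + 3)} (hj : 0 < j) : 0 < orient (v 0) (v j) x := by
  rw [orient_rotate] at hlast
  rw [← orient_rotate] at hzero
  rcases eq_or_ne j 1 with rfl | hj₁
  · exact hzero
  rcases eq_or_ne j (Fin.last _) with rfl | hj₂
  · exact hlast
  have h1j : 1 < j := (Fin.one_le_of_ne_zero hj.ne').lt_of_ne hj₁.symm
  have hjL : j < Fin.last _ := (Fin.le_last j).lt_of_ne hj₂
  exact (orient_pos_iff_of_pos (h Fin.zero_lt_one h1j) hlast hzero (h hj hjL)).1
    (h Fin.zero_lt_one (h1j.trans hjL))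

theorem orient_last_pos_of_beyond (h : IsConvexPolygon v) {x : Fin 2 → R}
    (hprev : 0 < orient (v (Fin.last (n + 1)).castSucc) (v (Fin.last _)) x)
    (hlast : 0 < orient (v (Fin.last _)) x (v 0)) {i : Fin (n + 3)} (hi : i < Fin.last _) :
    0 < orient (v i) (v (Fin.last _)) x := by
  obtain ⟨i, rfl⟩ := Fin.exists_castSucc_eq.2 hi.ne
  rcases (Fin.le_last i).eq_or_lt with rfl | hlt
  · exact hprev
  rw [← orient_rotate]
  rcases (Fin.zero_le i).eq_or_lt with rfl | hpos
  · exact hlast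
  rw [← orient_rotate] at hprev
  have h0i : (0 : Fin (n + 3)) < i.castSucc := hpos
  have hip : i.castSucc < (Fin.last (n + 1)).castSucc := hlt
  have hpL := Fin.castSucc_lt_last (Fin.last (n + 1))
  have hL {j k : Fin (n + 3)} (hjk : j < k) (hk : k < Fin.last _) :
      0 < orient (v (Fin.last _)) (v j) (v k) := by
    rw [← orient_rotate]
    exact h hjk hk
  exact (orient_pos_iff_of_pos hlast (hL hip hpL) hprev (hL h0i hi)).2 (hL (h0i.trans hip) hpL)

/-- The point `x` lies beyond the edge from the last vertex to the first one and between the lines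
through the two neighbouring edges. -/
theorem snoc (h : IsConvexPolygon v) {x : Fin 2 → R}
    (hprev : 0 < orient (v (Fin.last (n + 1)).castSucc) (v (Fin.last _)) x)
    (hlast : 0 < orient (v (Fin.last _)) x (v 0)) (hzero : 0 < orient x (v 0) (v 1)) :
    IsConvexPolygon (Fin.snoc v x : Fin (n + 4) → Fin 2 → R) := by
  have key {i j : Fin (n + 3)} (hij : i < j) : 0 < orient (v i) (v j) x := by
    have h0j := h.orient_zero_pos_of_beyond hlast hzero ((Fin.zero_le i).trans_lt hij)
    rcases (Fin.zero_le i).eq_or_lt with rfl | hi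
    · exact h0j
    have hiL := h.orient_last_pos_of_beyond hprev hlast (hij.trans_le (Fin.le_last j))
    rcases (Fin.le_last j).eq_or_lt with rfl | hj
    · exact hiL
    have h0i := h.orient_zero_pos_of_beyond hlast hzero hi
    rw [← orient_rotate] at h0i
    have hi0 {k : Fin (n + 3)} (hik : i < k) : 0 < orient (v i) (v k) (v 0) := by
      rw [orient_rotate]
      exact h hi hik
    exact (orient_pos_iff_of_pos (h hij hj) h0i (hi0 hij) hiL).2
      (hi0 (hij.trans hj))
  intro i j k hij hjk
  obtain ⟨i, rfl⟩ := Fin.exists_castSucc_eq.2 (Fin.ne_last_of_lt hij)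
  obtain ⟨j, rfl⟩ := Fin.exists_castSucc_eq.2 (Fin.ne_last_of_lt hjk)
  simp only [Fin.snoc_castSucc]
  cases k using Fin.lastCases with
  | last => rw [Fin.snoc_last]; exact key hij
  | cast k => rw [Fin.snoc_castSucc]; exact h hij hjk

theorem exists_forall_cross_lt (h : IsConvexPolygon v) (i : Fin (n + 3)) :
    ∃ δ, ∀ j ≠ i, cross δ (v i) < cross δ (v j) := by
  have zero {w : Fin (n + 3) → Fin 2 → R} (hw : IsConvexPolygon w) {j : Fin (n + 3)} (hj : 0 < j) :
      cross (w 1 - w (Fin.last _)) (w 0) < cross (w 1 - w (Fin.last _)) (w j) := by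
    have hsum : cross (w 1 - w (Fin.last _)) (w j) - cross (w 1 - w (Fin.last _)) (w 0) =
        orient (w 0) (w 1) (w j) + orient (w 0) (w j) (w (Fin.last _)) := by
      simp only [orient, cross, Pi.sub_apply]
      ring
    rw [← sub_pos, hsum]
    rcases eq_or_ne j 1 with rfl | hj₁
    · rw [orient_self_right, zero_add]
      exact hw Fin.zero_lt_one (Fin.lt_def.2 (by simp))
    have h1j : 1 < j := (Fin.one_le_of_ne_zero hj.ne').lt_of_ne hj₁.symm
    refine add_pos_of_pos_of_nonneg (hw Fin.zero_lt_one h1j) ?_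
    rcases (Fin.le_last j).eq_or_lt with rfl | hjL
    · rw [orient_self_right]
    · exact (hw hj hjL).le
  refine ⟨v (1 + i) - v (Fin.last _ + i), fun j hj => ?_⟩
  simpa using zero (h.rotate i) (Fin.pos_of_ne_zero (sub_ne_zero.2 hj))

theorem injective (h : IsConvexPolygon v) : Function.Injective v := by
  intro i j hij
  by_contra hne
  obtain ⟨δ, hδ⟩ := h.exists_forall_cross_lt i
  exact (hδ j (Ne.symm hne)).ne (congrArg (cross δ) hij)

end IsConvexPolygon

end Orientation

/-! ### Sorting a set in convex position into a convex polygon -/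

section ConvexPosition

variable {S : Set (Fin 2 → ℤ)}

theorem convexPosition_of_exists_cross_lt
    (h : ∀ v ∈ S, ∃ δ, ∀ w ∈ S, w ≠ v → cross δ v < cross δ w) : ConvexPosition S := by
  refine convexIndependent_of_exists_forall_lt ?_
  rintro _ ⟨v, hv, rfl⟩
  obtain ⟨δ, hδ⟩ := h v hv
  refine ⟨innerₗ _ !₂[-(δ 1 : ℝ), (δ 0 : ℝ)], ?_⟩
  have hinner (w : Fin 2 → ℤ) :
      innerₗ (EuclideanSpace ℝ (Fin 2)) !₂[-(δ 1 : ℝ), (δ 0 : ℝ)] (latticePoint w) =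
        (cross δ w : ℤ) := by
    simp [cross, innerₗ_apply_apply, PiLp.inner_apply]
    ring
  rintro _ ⟨w, hw, rfl⟩ hne
  rw [hinner, hinner, Int.cast_lt]
  exact hδ w hw fun e => hne (e ▸ rfl)

theorem IsConvexPolygon.convexPosition_range {n : ℕ} {v : Fin (n + 3) → Fin 2 → ℤ}
    (h : IsConvexPolygon v) : ConvexPosition (Set.range v) := by
  refine convexPosition_of_exists_cross_lt ?_
  rintro _ ⟨i, rfl⟩
  obtain ⟨δ, hδ⟩ := h.exists_forall_cross_lt i
  refine ⟨δ, ?_⟩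
  rintro _ ⟨j, rfl⟩ hne
  exact hδ j fun e => hne (e ▸ rfl)

theorem collinear_of_orient_eq_zero {a b c : Fin 2 → ℤ} (hab : a ≠ b) (h : orient a b c = 0) :
    Collinear ℝ {latticePoint a, latticePoint b, latticePoint c} := by
  have h' : ((b 0 - a 0) * (c 1 - a 1) - (b 1 - a 1) * (c 0 - a 0) : ℝ) = 0 := by exact_mod_cast h
  have hne : ((b 0 - a 0) ^ 2 + (b 1 - a 1) ^ 2 : ℝ) ≠ 0 := by
    intro h0
    have h0' : (b 0 - a 0) ^ 2 + (b 1 - a 1) ^ 2 = 0 := by exact_mod_cast h0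
    refine hab (funext <| Fin.forall_fin_two.2 ⟨?_, ?_⟩) <;> nlinarith
  refine (collinear_iff_of_mem (Set.mem_insert _ _)).2 ⟨latticePoint b - latticePoint a, ?_⟩
  simp only [Set.mem_insert_iff, Set.mem_singleton_iff, forall_eq_or_imp, forall_eq]
  refine ⟨⟨0, by simp⟩, ⟨1, by simp⟩, ⟨((b 0 - a 0) * (c 0 - a 0) + (b 1 - a 1) * (c 1 - a 1)) /
    ((b 0 - a 0) ^ 2 + (b 1 - a 1) ^ 2), ?_⟩⟩
  ext i
  fin_cases i <;> simp <;> field_simp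
  · linear_combination (a 1 - b 1 : ℝ) * h'
  · linear_combination (b 0 - a 0 : ℝ) * h'

theorem ConvexPosition.orient_ne_zero (h : ConvexPosition S) {a b c : Fin 2 → ℤ} (ha : a ∈ S)
    (hb : b ∈ S) (hc : c ∈ S) (hab : a ≠ b) (hac : a ≠ c) (hbc : b ≠ c) : orient a b c ≠ 0 :=
  fun h0 => h.not_collinear ha hb hc hab hac hbc (collinear_of_orient_eq_zero hab h0)

end ConvexPosition

section Sorting

variable {S : Finset (Fin 2 → ℤ)}

theorem ConvexPosition.exists_coeff_lt (h : ConvexPosition (S : Set (Fin 2 → ℤ)))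
    {v : Fin 2 → ℤ} (hv : v ∈ S) :
    ∃ p q : ℝ, ∀ w ∈ S, w ≠ v → p * v 0 + q * v 1 < p * w 0 + q * w 1 := by
  obtain ⟨x, hx⟩ := h.exists_inner_lt hv
  refine ⟨x 0, x 1, fun w hw hne => ?_⟩
  simpa [PiLp.inner_apply, mul_comm] using hx w hw hne

theorem ConvexPosition.orient_pos (h : ConvexPosition (S : Set (Fin 2 → ℤ)))
    {a b c d : Fin 2 → ℤ} (ha : a ∈ S) (hb : b ∈ S) (hc : c ∈ S) (hd : d ∈ S)
    (habc : 0 < orient a b c) (hacd : 0 < orient a c d) : 0 < orient b c d := by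
  have hac : a ≠ c := by rintro rfl; rw [orient_self_left] at hacd; exact hacd.false
  have hbc : b ≠ c := by rintro rfl; rw [orient_self_right] at habc; exact habc.false
  have hdc : d ≠ c := by rintro rfl; rw [orient_self_right] at hacd; exact hacd.false
  obtain ⟨p, q, hpq⟩ := h.exists_coeff_lt hc
  have ha' := hpq a ha hac
  have hb' := hpq b hb hbc
  have hd' := hpq d hd hdc
  have habc' : (0 : ℝ) < orient a b c := Int.cast_pos.2 habc
  have hacd' : (0 : ℝ) < orient a c d := Int.cast_pos.2 hacd
  have hpos := add_pos (mul_pos hacd' (sub_pos.2 hb')) (mul_pos habc' (sub_pos.2 hd'))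
  -- The areas of the triangles satisfy `acd • (b - c) + abc • (d - c) = bcd • (a - c)`.
  have hsum : orient a c d * (p * b 0 + q * b 1 - (p * c 0 + q * c 1)) +
      orient a b c * (p * d 0 + q * d 1 - (p * c 0 + q * c 1)) =
        orient b c d * (p * a 0 + q * a 1 - (p * c 0 + q * c 1)) := by
    simp only [orient, cross, Pi.sub_apply]
    push_cast
    ring
  rw [hsum] at hpos
  exact Int.cast_pos.1 (pos_of_mul_pos_left hpos (sub_pos.2 ha').le)

theorem ConvexPosition.exists_slope (h : ConvexPosition (S : Set (Fin 2 → ℤ))) {a : Fin 2 → ℤ}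
    (ha : a ∈ S) : ∃ m : (Fin 2 → ℤ) → ℝ, ∀ x ∈ S, x ≠ a → ∀ y ∈ S, y ≠ a →
      (m x < m y ↔ 0 < orient a x y) := by
  obtain ⟨p, q, hpq⟩ := h.exists_coeff_lt ha
  -- The tangent of the angle between `(p, q)` and `x - a`.
  refine ⟨fun x => (p * (x 1 - a 1) - q * (x 0 - a 0)) / (p * (x 0 - a 0) + q * (x 1 - a 1)),
    fun x hx hxa y hy hya => ?_⟩
  have hx' := hpq x hx hxa
  have hy' := hpq y hy hya
  have hpq0 : 0 < p ^ 2 + q ^ 2 := by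
    refine (by positivity : 0 ≤ p ^ 2 + q ^ 2).lt_of_ne' fun h0 => ?_
    obtain ⟨rfl, rfl⟩ : p = 0 ∧ q = 0 := by constructor <;> nlinarith
    simp at hx'
  have hcross : (p * (y 1 - a 1) - q * (y 0 - a 0)) * (p * (x 0 - a 0) + q * (x 1 - a 1)) -
      (p * (x 1 - a 1) - q * (x 0 - a 0)) * (p * (y 0 - a 0) + q * (y 1 - a 1)) =
        (p ^ 2 + q ^ 2) * (orient a x y : ℤ) := by
    simp only [orient, cross, Pi.sub_apply]
    push_cast
    ring
  rw [div_lt_div_iff₀ (by linarith) (by linarith), ← sub_pos, hcross, mul_pos_iff_of_pos_left hpq0,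
    Int.cast_pos]

theorem exists_strictMono_comp_of_injOn {α β : Type*} [LinearOrder β] {T : Finset α} {n : ℕ}
    (hT : T.card = n) {f : α → β} (hf : Set.InjOn f T) :
    ∃ v : Fin n → α, StrictMono (f ∘ v) ∧ Set.range v = T := by
  let e := (T.image f).orderEmbOfFin ((Finset.card_image_of_injOn hf).trans hT)
  have he (i : Fin n) : ∃ x ∈ T, f x = e i := Finset.mem_image.1 (Finset.orderEmbOfFin_mem _ _ i)
  choose v hvT hv using he
  have hmono : StrictMono (f ∘ v) := fun i j hij => by
    simpa only [Function.comp_apply, hv] using e.strictMono hij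
  refine ⟨v, hmono, ?_⟩
  have hmap : Finset.univ.map ⟨v, hmono.injective.of_comp⟩ = T := by
    refine Finset.eq_of_subset_of_card_le (fun x hx => ?_) (by simp [hT])
    obtain ⟨i, -, rfl⟩ := Finset.mem_map.1 hx
    exact hvT i
  rw [← hmap, Finset.coe_map, Finset.coe_univ, Set.image_univ, Function.Embedding.coeFn_mk]

theorem ConvexPosition.exists_isConvexPolygon (h : ConvexPosition (S : Set (Fin 2 → ℤ))) {n : ℕ}
    (hS : S.card = n + 1) :
    ∃ v : Fin (n + 1) → Fin 2 → ℤ, IsConvexPolygon v ∧ Set.range v = S := by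
  obtain ⟨a, ha⟩ : S.Nonempty := Finset.card_pos.1 (by omega)
  obtain ⟨m, hm⟩ := h.exists_slope ha
  have hm' {x y : Fin 2 → ℤ} (hx : x ∈ S.erase a) (hy : y ∈ S.erase a) :
      m x < m y ↔ 0 < orient a x y :=
    hm x (Finset.mem_of_mem_erase hx) (Finset.ne_of_mem_erase hx) y (Finset.mem_of_mem_erase hy)
      (Finset.ne_of_mem_erase hy)
  have hinj : Set.InjOn m (S.erase a) := by
    intro x hx y hy hxy
    by_contra hne
    have hpos := (hm' hx hy).not.1 hxy.not_lt
    have hneg := (hm' hy hx).not.1 hxy.not_gt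
    rw [orient_swap] at hneg
    exact h.orient_ne_zero ha (Finset.mem_of_mem_erase hx) (Finset.mem_of_mem_erase hy)
      (Finset.ne_of_mem_erase hx).symm (Finset.ne_of_mem_erase hy).symm hne (by omega)
  obtain ⟨v, hv, hrange⟩ := exists_strictMono_comp_of_injOn
    (show (S.erase a).card = n by rw [Finset.card_erase_of_mem ha, hS, Nat.add_sub_cancel]) hinj
  have hvS (i : Fin n) : v i ∈ S.erase a := Finset.mem_coe.1 (hrange ▸ Set.mem_range_self i)
  have hfan (i j : Fin n) (hij : i < j) : 0 < orient a (v i) (v j) :=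
    (hm' (hvS i) (hvS j)).1 (hv hij)
  refine ⟨Fin.cons a v, IsConvexPolygon.cons ?_ hfan, ?_⟩
  · intro i j k hij hjk
    exact h.orient_pos ha (Finset.mem_of_mem_erase (hvS i)) (Finset.mem_of_mem_erase (hvS j))
      (Finset.mem_of_mem_erase (hvS k)) (hfan i j hij) (hfan j k hjk)
  · rw [Fin.range_cons, hrange, ← Finset.coe_insert, Finset.insert_erase ha]

end Sorting

/-! ### Convex chains -/

/-- Every point of `S` strictly minimises over `S` a linear functional that is positive on `u`. This
means that `S` stays in convex position when the point at infinity in the direction of `u` is added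
to it. -/
def ConvexChain (u : Fin 2 → ℤ) (S : Set (Fin 2 → ℤ)) : Prop :=
  ∀ v ∈ S, ∃ δ, 0 < cross δ u ∧ ∀ w ∈ S, w ≠ v → cross δ v < cross δ w

namespace ConvexChain

variable {u : Fin 2 → ℤ} {S : Set (Fin 2 → ℤ)}

theorem convexPosition (h : ConvexChain u S) : ConvexPosition S :=
  convexPosition_of_exists_cross_lt fun v hv => (h v hv).imp fun _ hδ => hδ.2

theorem ne_zero (h : ConvexChain u S) (hS : S.Nonempty) : u ≠ 0 := by
  rintro rfl
  obtain ⟨v, hv⟩ := hS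
  obtain ⟨δ, hδ, -⟩ := h v hv
  simp [cross] at hδ

end ConvexChain

theorem convexChain_range_of_forall {ι : Type*} {v : ι → Fin 2 → ℤ} {u : Fin 2 → ℤ}
    (h : ∀ i, ∃ δ, 0 < cross δ u ∧ ∀ j ≠ i, cross δ (v i) < cross δ (v j)) :
    ConvexChain u (Set.range v) := by
  rintro _ ⟨i, rfl⟩
  obtain ⟨δ, hδu, hδ⟩ := h i
  refine ⟨δ, hδu, ?_⟩
  rintro _ ⟨j, rfl⟩ hne
  exact hδ j fun e => hne (e ▸ rfl)

theorem IsConvexPolygon.convexChain_range {ι : Type*} [LinearOrder ι] [SuccOrder ι] [PredOrder ι]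
    [Nontrivial ι] {v : ι → Fin 2 → ℤ} (h : IsConvexPolygon v) {u : Fin 2 → ℤ}
    (hu : StrictMono fun i => cross (v i) u) : ConvexChain u (Set.range v) := by
  refine convexChain_range_of_forall fun i => ?_
  by_cases hmin : IsMin i
  · have hsucc := Order.covBy_succ_of_not_isMax hmin.not_isMax
    refine ⟨v (Order.succ i) - v i - u, ?_, fun j hj => ?_⟩
    · have := hu hsucc.lt
      simp only [cross, Pi.sub_apply] at this ⊢
      linarith
    · have hlt := hu ((hmin.isBot j).lt_of_ne' hj)
      have hnonneg := h.orient_nonneg_of_covBy hsucc j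
      simp only [orient, cross, Pi.sub_apply] at hlt hnonneg ⊢
      linarith
  have hpred := Order.pred_covBy_of_not_isMin hmin
  by_cases hmax : IsMax i
  · refine ⟨v i - v (Order.pred i) + u, ?_, fun j hj => ?_⟩
    · have := hu hpred.lt
      simp only [cross, Pi.sub_apply, Pi.add_apply] at this ⊢
      linarith
    · have hlt := hu ((hmax.isTop j).lt_of_ne hj)
      have hnonneg := h.orient_nonneg_of_covBy hpred j
      simp only [orient, cross, Pi.sub_apply, Pi.add_apply] at hlt hnonneg ⊢
      linarith
  · have hsucc := Order.covBy_succ_of_not_isMax hmax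
    refine ⟨v (Order.succ i) - v (Order.pred i), ?_, fun j hj => ?_⟩
    · have := hu (hpred.lt.trans hsucc.lt)
      simp only [cross, Pi.sub_apply] at this ⊢
      linarith
    · have hpos : 0 < orient (v (Order.pred i)) (v i) (v j) +
          orient (v i) (v (Order.succ i)) (v j) := by
        rcases eq_or_ne j (Order.pred i) with rfl | hjp
        · exact add_pos_of_nonneg_of_pos (h.orient_nonneg_of_covBy hpred _)
            (h.orient_pos_of_covBy hsucc hj (hpred.lt.trans hsucc.lt).ne)
        · exact add_pos_of_pos_of_nonneg (h.orient_pos_of_covBy hpred hjp hj)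
            (h.orient_nonneg_of_covBy hsucc j)
      simp only [orient, cross, Pi.sub_apply] at hpos ⊢
      linarith

/-! ### Parabolas -/

section Parabola

/-- The lattice points of a parabola whose axis is directed by `u`. -/
def parabola (w u : Fin 2 → ℤ) (k : ℤ) : Fin 2 → ℤ := k • w + k ^ 2 • u

/-- A tangent vector to the parabola at the point of parameter `k`. The factor `cross w u` orients
it so that the parabola lies on its positive side. -/
def parabolaTangent (w u : Fin 2 → ℤ) (k : ℤ) : Fin 2 → ℤ := cross w u • (w + (2 * k) • u)

theorem cross_parabolaTangent (w u x : Fin 2 → ℤ) (k : ℤ) :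
    cross (parabolaTangent w u k) x = cross w u * cross w x + 2 * k * cross w u * cross u x := by
  simp only [cross, parabolaTangent, Pi.smul_apply, Pi.add_apply, smul_eq_mul]
  ring

theorem cross_parabolaTangent_parabola (w u : Fin 2 → ℤ) (k j : ℤ) :
    cross (parabolaTangent w u k) (parabola w u j) = cross w u ^ 2 * (j ^ 2 - 2 * k * j) := by
  simp only [cross, parabola, parabolaTangent, Pi.smul_apply, Pi.add_apply, smul_eq_mul]
  ring

variable {w u : Fin 2 → ℤ}

theorem cross_parabolaTangent_lt (h : cross w u ≠ 0) {k j : ℤ} (hjk : j ≠ k) :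
    cross (parabolaTangent w u k) (parabola w u k) <
      cross (parabolaTangent w u k) (parabola w u j) := by
  have hsq : 0 < cross w u ^ 2 * (j - k) ^ 2 := by
    have := sub_ne_zero.2 hjk
    positivity
  rw [cross_parabolaTangent_parabola, cross_parabolaTangent_parabola]
  linarith

theorem parabola_injective (h : cross w u ≠ 0) : Function.Injective (parabola w u) := by
  intro k j hkj
  by_contra hne
  exact (cross_parabolaTangent_lt h (Ne.symm hne)).ne (congrArg _ hkj)

theorem cross_parabolaTangent_right_pos (h : cross w u ≠ 0) (k : ℤ) :
    0 < cross (parabolaTangent w u k) u := by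
  have hsq : cross (parabolaTangent w u k) u = cross w u ^ 2 := by
    rw [cross_parabolaTangent]
    simp only [cross]
    ring
  rw [hsq]
  positivity

theorem cross_parabolaTangent_left_pos (h : cross w u ≠ 0) {k : ℤ} (hk : k < 0) :
    0 < cross (parabolaTangent w u k) w := by
  have hsq : cross (parabolaTangent w u k) w = 2 * -k * cross w u ^ 2 := by
    rw [cross_parabolaTangent]
    simp only [cross]
    ring
  have := neg_pos.2 hk
  rw [hsq]
  positivity

theorem convexChain_image_parabola (h : cross w u ≠ 0) {x : Fin 2 → ℤ} {s : Set ℤ}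
    (hx : ∀ k ∈ s, 0 < cross (parabolaTangent w u k) x) : ConvexChain x (parabola w u '' s) := by
  rintro _ ⟨k, hk, rfl⟩
  refine ⟨parabolaTangent w u k, hx k hk, ?_⟩
  rintro _ ⟨j, -, rfl⟩ hne
  exact cross_parabolaTangent_lt h fun e => hne (e ▸ rfl)

/-- One side of a parabola is a chain both for the axis and for the tangent at the apex. -/
theorem exists_convexChain_card_eq (h : cross w u ≠ 0) (n : ℕ) :
    ∃ S : Finset (Fin 2 → ℤ), S.card = n ∧ ConvexChain w (S : Set (Fin 2 → ℤ)) ∧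
      ConvexChain u (S : Set (Fin 2 → ℤ)) := by
  refine ⟨(Finset.Ico (-n : ℤ) 0).image (parabola w u), ?_, ?_, ?_⟩
  · rw [Finset.card_image_of_injective _ (parabola_injective h), Int.card_Ico]
    simp
  all_goals rw [Finset.coe_image]; refine convexChain_image_parabola h fun k hk => ?_
  · exact cross_parabolaTangent_left_pos h (Finset.mem_Ico.1 hk).2
  · exact cross_parabolaTangent_right_pos h k

theorem eventually_quadratic_pos {a : ℤ} (ha : 0 < a) (b c : ℤ) :
    ∀ᶠ k : ℤ in Filter.atTop, 0 < a * k ^ 2 + b * k + c := by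
  filter_upwards [Filter.eventually_ge_atTop (|b| + |c| + 1)] with k hk
  have hb := neg_abs_le b
  have hc := neg_abs_le c
  have hk0 : 1 ≤ k := by linarith [abs_nonneg b, abs_nonneg c]
  nlinarith [mul_nonneg (abs_nonneg c) (sub_nonneg.2 hk0)]

theorem ConvexChain.exists_union_parabola {S : Finset (Fin 2 → ℤ)}
    (hS : ConvexChain u (S : Set (Fin 2 → ℤ))) (h : cross w u ≠ 0) :
    ∃ N : ℤ, ConvexChain u (S ∪ parabola w u '' Set.Ici N) := by
  choose! δ hδu hδ using hS
  have above (v : Fin 2 → ℤ) (hv : v ∈ S) :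
      ∀ᶠ k in Filter.atTop, cross (δ v) v < cross (δ v) (parabola w u k) := by
    filter_upwards [eventually_quadratic_pos (hδu v hv) (cross (δ v) w) (-cross (δ v) v)] with k hk
    simp only [cross, parabola, Pi.smul_apply, Pi.add_apply, smul_eq_mul] at hk ⊢
    linarith
  have inside (v : Fin 2 → ℤ) : ∀ᶠ k in Filter.atTop,
      cross (parabolaTangent w u k) (parabola w u k) < cross (parabolaTangent w u k) v := by
    filter_upwards [eventually_quadratic_pos (sq_pos_of_ne_zero h) (2 * cross w u * cross u v)
      (cross w u * cross w v)] with k hk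
    rw [cross_parabolaTangent_parabola, cross_parabolaTangent]
    linarith
  obtain ⟨N, hN⟩ := Filter.eventually_atTop.1 (((Filter.eventually_all_finset S).2 above).and
    ((Filter.eventually_all_finset S).2 fun v _ => inside v))
  refine ⟨N, ?_⟩
  rintro v (hv | ⟨k, hk, rfl⟩)
  · refine ⟨δ v, hδu v hv, ?_⟩
    rintro x (hx | ⟨j, hj, rfl⟩) hne
    · exact hδ v hv x hx hne
    · exact (hN j hj).1 v hv
  · refine ⟨parabolaTangent w u k, cross_parabolaTangent_right_pos h k, ?_⟩
    rintro x (hx | ⟨j, -, rfl⟩) hne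
    · exact (hN k hk).2 x hx
    · exact cross_parabolaTangent_lt h fun e => hne (e ▸ rfl)

theorem exists_cross_ne_zero {u u' : Fin 2 → ℤ} (hu : u ≠ 0) (hu' : u' ≠ 0) :
    ∃ w, cross w u ≠ 0 ∧ cross w u' ≠ 0 := by
  have eventually {x : Fin 2 → ℤ} (hx : x ≠ 0) :
      ∀ᶠ t : ℤ in Filter.atTop, cross ![1, t] x ≠ 0 := by
    filter_upwards [Filter.eventually_gt_atTop |x 1|] with t ht h0
    have hx1 : x 1 = t * x 0 := by simpa [cross, sub_eq_zero] using h0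
    have hx1' : x 1 = 0 := Int.eq_zero_of_abs_lt_dvd ⟨_, hx1⟩ ht
    have ht0 : t ≠ 0 := ((abs_nonneg _).trans_lt ht).ne'
    have hx0 : x 0 = 0 := by simpa [hx1', ht0] using hx1
    exact hx (funext (Fin.forall_fin_two.2 ⟨hx0, hx1'⟩))
  obtain ⟨t, ht, ht'⟩ := ((eventually hu).and (eventually hu')).exists
  exact ⟨_, ht, ht'⟩

end Parabola

/-! ### Insertions and deletions of lattice points -/

section InsertionGraph

variable {d n : ℕ}

/-- The graph of the insertions that turn `n` lattice points into `n + 1` lattice points in convex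
position. -/
def insertionGraph (n : ℕ) : SimpleGraph (Finset (Fin d → ℤ)) :=
  SimpleGraph.fromRel fun S T => S.card = n ∧ S ⋖ T ∧ ConvexPosition (T : Set (Fin d → ℤ))

theorem insertionGraph_adj_insert {S : Finset (Fin d → ℤ)} {x : Fin d → ℤ} (hS : S.card = n)
    (hx : x ∉ S) (h : ConvexPosition (insert x (S : Set (Fin d → ℤ)))) :
    (insertionGraph n).Adj S (insert x S) := by
  have hcov : S ⋖ insert x S := Finset.covBy_iff_exists_insert.2 ⟨x, hx, rfl⟩
  exact (SimpleGraph.fromRel_adj ..).2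
    ⟨hcov.lt.ne, .inl ⟨hS, hcov, by rwa [Finset.coe_insert]⟩⟩

theorem ConvexPosition.insertionGraph_reachable_of_subset {W : Set (Fin d → ℤ)}
    (hW : ConvexPosition W) {S T : Finset (Fin d → ℤ)} (hSW : (S : Set (Fin d → ℤ)) ⊆ W)
    (hTW : (T : Set (Fin d → ℤ)) ⊆ W) (hS : S.card = n) (hT : T.card = n) :
    (insertionGraph n).Reachable S T := by
  induction hk : (S \ T).card generalizing S with
  | zero =>
    have hST : S ⊆ T := Finset.sdiff_eq_empty_iff_subset.1 (Finset.card_eq_zero.1 hk)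
    rw [Finset.eq_of_subset_of_card_le hST (hT.trans hS.symm).le]
  | succ k ih =>
    obtain ⟨s, hs⟩ : (S \ T).Nonempty := Finset.card_pos.1 (by omega)
    obtain ⟨t, ht⟩ : (T \ S).Nonempty :=
      Finset.card_pos.1 (by rw [Finset.card_sdiff_comm (hT.trans hS.symm)]; omega)
    have hsS : s ∈ S := (Finset.mem_sdiff.1 hs).1
    obtain ⟨htT, htS⟩ := Finset.mem_sdiff.1 ht
    have hst : s ≠ t := ne_of_mem_of_not_mem hsS htS
    have hUW : insert t (S : Set (Fin d → ℤ)) ⊆ W := Set.insert_subset (hTW htT) hSW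
    have hsU : s ∉ insert t (S.erase s) := by simp [hst]
    have hU : insert s (insert t (S.erase s)) = insert t S := by
      rw [Finset.insert_comm, Finset.insert_erase hsS]
    have hcard : (insert t (S.erase s)).card = n := by
      rw [Finset.card_insert_of_notMem (by simp [htS]), Finset.card_erase_add_one hsS, hS]
    have hsub : (insert t (S.erase s) : Finset (Fin d → ℤ)) ⊆ insert t S :=
      Finset.insert_subset_insert t (S.erase_subset s)
    have hadd := insertionGraph_adj_insert hS htS (hW.mono hUW)
    have hdel := insertionGraph_adj_insert hcard hsU
      (by rw [← Finset.coe_insert, hU, Finset.coe_insert]; exact hW.mono hUW)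
    rw [hU] at hdel
    refine hadd.reachable.trans (hdel.symm.reachable.trans (ih ?_ hcard ?_))
    · exact (Finset.coe_subset.2 hsub).trans (by rwa [Finset.coe_insert])
    · rw [Finset.insert_sdiff_of_mem _ htT, Finset.erase_sdiff_comm, Finset.card_erase_of_mem hs,
        hk, Nat.add_sub_cancel]

end InsertionGraph

section Chains

variable {n : ℕ} {S T : Finset (Fin 2 → ℤ)}

theorem ConvexChain.insertionGraph_reachable_of_cross_ne_zero {w u : Fin 2 → ℤ} (h : cross w u ≠ 0)
    (hSu : ConvexChain u (S : Set (Fin 2 → ℤ))) (hTu : ConvexChain u (T : Set (Fin 2 → ℤ)))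
    (hS : S.card = n) (hT : T.card = n) : (insertionGraph n).Reachable S T := by
  obtain ⟨M, hM⟩ := hSu.exists_union_parabola h
  obtain ⟨N, hN⟩ := hTu.exists_union_parabola h
  let far := (Finset.Ico (max M N) (max M N + n)).image (parabola w u)
  have hfar : far.card = n := by
    rw [Finset.card_image_of_injective _ (parabola_injective h), Int.card_Ico]
    simp
  have far_subset {K : ℤ} (hK : K ≤ max M N) :
      (far : Set (Fin 2 → ℤ)) ⊆ parabola w u '' Set.Ici K := by
    rw [Finset.coe_image]
    exact Set.image_mono fun k hk => hK.trans (Finset.mem_Ico.1 hk).1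
  exact (hM.convexPosition.insertionGraph_reachable_of_subset Set.subset_union_left
      ((far_subset (le_max_left M N)).trans Set.subset_union_right) hS hfar).trans
    (hN.convexPosition.insertionGraph_reachable_of_subset Set.subset_union_left
      ((far_subset (le_max_right M N)).trans Set.subset_union_right) hT hfar).symm

theorem ConvexChain.insertionGraph_reachable {u u' : Fin 2 → ℤ}
    (hSu : ConvexChain u (S : Set (Fin 2 → ℤ))) (hTu : ConvexChain u' (T : Set (Fin 2 → ℤ)))
    (hS : S.card = n) (hT : T.card = n) (hn : n ≠ 0) : (insertionGraph n).Reachable S T := by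
  have hSne : S.Nonempty := Finset.card_ne_zero.1 (hS ▸ hn)
  have hTne : T.Nonempty := Finset.card_ne_zero.1 (hT ▸ hn)
  obtain ⟨w, hwu, hwu'⟩ := exists_cross_ne_zero (hSu.ne_zero hSne) (hTu.ne_zero hTne)
  obtain ⟨R, hR, hRw, hRu⟩ := exists_convexChain_card_eq hwu n
  obtain ⟨R', hR', hRw', hRu'⟩ := exists_convexChain_card_eq hwu' n
  have huw : cross u w ≠ 0 := fun h => hwu (by simp only [cross] at h ⊢; linarith)
  exact (hSu.insertionGraph_reachable_of_cross_ne_zero hwu hRu hS hR).trans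
    ((hRw.insertionGraph_reachable_of_cross_ne_zero huw hRw' hR hR').trans
    (hRu'.insertionGraph_reachable_of_cross_ne_zero hwu' hTu hR' hT))

end Chains

section Transfer

variable {d n : ℕ}

theorem insertionGraph_adj_right {S T : Finset (Fin d → ℤ)} (h : (insertionGraph n).Adj S T) :
    ConvexPosition (T : Set (Fin d → ℤ)) ∧ (T.card = n ∨ T.card = n + 1) := by
  obtain ⟨-, ⟨hS, hcov, hT⟩ | ⟨hT, hcov, hS⟩⟩ := (SimpleGraph.fromRel_adj ..).1 h
  · exact ⟨hT, .inr (hS ▸ (Order.covBy_iff_add_one_eq.1 hcov.card_finset).symm)⟩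
  · exact ⟨hS.mono (Finset.coe_subset.2 hcov.le), .inl hT⟩

theorem polytopeGraph_adj_of_insertionGraph_adj {S T : Finset (Fin d → ℤ)}
    (h : (insertionGraph n).Adj S T) {P Q : FullPolytope d} (hP : P.vertices = latticePoint '' S)
    (hQ : Q.vertices = latticePoint '' T) : (polytopeGraph d).Adj P Q := by
  wlog hST : S ⋖ T generalizing S T P Q
  · obtain ⟨-, ⟨-, hcov, -⟩ | ⟨-, hcov, -⟩⟩ := (SimpleGraph.fromRel_adj ..).1 h
    · exact absurd hcov hST
    · exact (this h.symm hQ hP hcov).symm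
  obtain ⟨x, hx, rfl⟩ := Finset.covBy_iff_exists_insert.1 hST
  refine FullPolytope.adj_of_vertices_eq_insert (x := latticePoint x) ?_ ?_
  · rwa [hP, latticePoint_injective.mem_set_image]
  · rw [hP, hQ, Finset.coe_insert, Set.image_insert_eq]

theorem FullPolytope.ncard_vertices {P : FullPolytope d} {S : Finset (Fin d → ℤ)}
    (hP : P.vertices = latticePoint '' S) : P.vertices.ncard = S.card := by
  rw [hP, Set.ncard_image_of_injective _ latticePoint_injective, Set.ncard_coe_finset]

theorem reachable_of_insertionGraph_reachable (hn : 2 < n) {S T : Finset (Fin 2 → ℤ)}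
    (h : (insertionGraph n).Reachable S T)
    {P Q : {P : {P : FullPolytope 2 // P.IsLattice} |
      P.1.vertices.ncard = n ∨ P.1.vertices.ncard = n + 1}}
    (hP : P.1.1.vertices = latticePoint '' S) (hQ : Q.1.1.vertices = latticePoint '' T) :
    ((latticePolytopeGraph 2).induce _).Reachable P Q := by
  obtain ⟨walk⟩ := h
  induction walk generalizing P with
  | nil =>
    rw [Subtype.ext (Subtype.ext (FullPolytope.vertices_injective (hP.trans hQ.symm)))]
  | cons hadj _ ih =>
    obtain ⟨hU, hcard⟩ := insertionGraph_adj_right hadj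
    obtain ⟨R, hR, hRU⟩ := hU.exists_vertices_eq (by omega)
    rw [← FullPolytope.ncard_vertices hRU] at hcard
    have hPR := polytopeGraph_adj_of_insertionGraph_adj hadj hP hRU
    exact (SimpleGraph.Adj.reachable (v := ⟨⟨R, hR⟩, hcard⟩) hPR).trans (ih hRU hQ)

end Transfer

/-! ### Pentagons -/

section Pentagon

section Area

variable {R : Type*} [CommRing R]

/-- Twice the signed area of the ear of a pentagon with apex `v (i + 1)`. -/
def ear (v : Fin 5 → Fin 2 → R) (i : Fin 5) : R := orient (v i) (v (i + 1)) (v (i + 2))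

/-- The determinant of the two edges next to the edge from `v (i + 1)` to `v (i + 2)`. In a convex
pentagon it is positive if and only if these two edges meet when extended beyond that edge. -/
def edgeCross (v : Fin 5 → Fin 2 → R) (i : Fin 5) : R :=
  cross (v (i + 1) - v i) (v (i + 3) - v (i + 2))

theorem ear_rotate (v : Fin 5 → Fin 2 → R) (i k : Fin 5) :
    ear (fun j => v (j + k)) i = ear v (i + k) := by
  simp only [ear, add_right_comm]

theorem edgeCross_rotate (v : Fin 5 → Fin 2 → R) (i k : Fin 5) :
    edgeCross (fun j => v (j + k)) i = edgeCross v (i + k) := by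
  simp only [edgeCross, add_right_comm]

theorem ear_add_edgeCross (v : Fin 5 → Fin 2 → R) (i : Fin 5) :
    ear v i + edgeCross v i = edgeCross v (i + 3) + ear v (i + 4) := by
  simp only [ear, edgeCross, orient, cross, Pi.sub_apply, add_assoc, Fin.isValue, Fin.reduceAdd,
    add_zero]
  ring

theorem ear_mul_ear (v : Fin 5 → Fin 2 → R) (i : Fin 5) :
    ear v i * ear v (i + 2) =
      edgeCross v i * edgeCross v (i + 1) + edgeCross v (i + 3) * ear v (i + 1) := by
  simp only [ear, edgeCross, orient, cross, Pi.sub_apply, add_assoc, Fin.isValue, Fin.reduceAdd,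
    add_zero]
  ring

theorem IsConvexPolygon.ear_pos [LinearOrder R] {v : Fin 5 → Fin 2 → R} (h : IsConvexPolygon v)
    (i : Fin 5) : 0 < ear v i := by
  have hi : 0 < ear (fun j => v (j + i)) 0 := h.rotate i Fin.zero_lt_one (by decide)
  rwa [ear_rotate, zero_add] at hi

end Area

theorem sq_ne_sq_add_mul {p q : ℤ} (hp : p ≠ 0) : p ^ 2 ≠ q ^ 2 + q * p := by
  intro h
  have hq : q ≠ 0 := by
    rintro rfl
    simp [hp] at h
  have hroots : (p - Real.goldenRatio * q) * (p - Real.goldenConj * q) = 0 := by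
    have hℝ : (p ^ 2 : ℝ) = q ^ 2 + q * p := by exact_mod_cast h
    linear_combination hℝ - p * q * Real.goldenRatio_add_goldenConj +
      q ^ 2 * Real.goldenRatio_mul_goldenConj
  rcases mul_eq_zero.1 hroots with hφ | hψ
  · exact (Real.goldenRatio_irrational.mul_intCast hq).ne_int p (sub_eq_zero.1 hφ).symm
  · exact (Real.goldenConj_irrational.mul_intCast hq).ne_int p (sub_eq_zero.1 hψ).symm

theorem IsConvexPolygon.exists_ear_lt {v : Fin 5 → Fin 2 → ℤ} (h : IsConvexPolygon v) :
    ∃ i, ear v i < ear v (i + 1) := by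
  by_contra! hle
  have h₀ : ear v 1 ≤ ear v 0 := hle 0
  have h₁ : ear v 2 ≤ ear v 1 := hle 1
  have h₂ : ear v 3 ≤ ear v 2 := hle 2
  have h₃ : ear v 4 ≤ ear v 3 := hle 3
  have h₄ : ear v 0 ≤ ear v 4 := hle 4
  have hc₃ : ear v 0 + edgeCross v 0 = edgeCross v 3 + ear v 4 := ear_add_edgeCross v 0
  have hc₁ : ear v 3 + edgeCross v 3 = edgeCross v 1 + ear v 2 := ear_add_edgeCross v 3
  have hmul : ear v 0 * ear v 2 = edgeCross v 0 * edgeCross v 1 + edgeCross v 3 * ear v 1 :=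
    ear_mul_ear v 0
  refine sq_ne_sq_add_mul (h.ear_pos 0).ne' (q := edgeCross v 0) ?_
  rw [show ear v 2 = ear v 0 by linarith, show ear v 1 = ear v 0 by linarith,
    show edgeCross v 1 = edgeCross v 0 by linarith,
    show edgeCross v 3 = edgeCross v 0 by linarith] at hmul
  linarith

/-- The lattice points of `S` can be turned into the points of a convex chain by insertions and
deletions that keep `n` or `n + 1` points. -/
def ReachesChain (n : ℕ) (S : Finset (Fin 2 → ℤ)) : Prop :=
  ∃ T u, (insertionGraph n).Reachable S T ∧ T.card = n ∧ ConvexChain u (T : Set (Fin 2 → ℤ))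

theorem ReachesChain.of_reachable {n : ℕ} {S T : Finset (Fin 2 → ℤ)} (hT : ReachesChain n T)
    (h : (insertionGraph n).Reachable S T) : ReachesChain n S :=
  let ⟨U, u, hTU, hU⟩ := hT
  ⟨U, u, h.trans hTU, hU⟩

theorem ReachesChain.of_rotate {n : ℕ} {v : Fin (n + 1) → Fin 2 → ℤ} {m : ℕ} (k : Fin (n + 1))
    (h : ReachesChain m (Finset.univ.image fun j => v (j + k))) :
    ReachesChain m (Finset.univ.image v) := by
  have himage : (Finset.univ.image fun j => v (j + k)) = Finset.univ.image v := by
    rw [← Finset.coe_inj]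
    simpa [Function.comp_def] using EquivLike.range_comp v (Equiv.addRight k)
  rwa [himage] at h

namespace IsConvexPolygon

theorem card_image {n : ℕ} {v : Fin (n + 3) → Fin 2 → ℤ} (h : IsConvexPolygon v) :
    (Finset.univ.image v).card = n + 3 := by
  rw [Finset.card_image_of_injective _ h.injective, Finset.card_fin]

theorem insertionGraph_reachable_succAbove {n : ℕ} {v : Fin (n + 4) → Fin 2 → ℤ}
    (h : IsConvexPolygon v) (i j : Fin (n + 4)) :
    (insertionGraph (n + 3)).Reachable (Finset.univ.image (v ∘ i.succAbove))
      (Finset.univ.image (v ∘ j.succAbove)) := by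
  have hsub (k : Fin (n + 4)) :
      (Finset.univ.image (v ∘ k.succAbove) : Set (Fin 2 → ℤ)) ⊆ Set.range v := by
    simpa [Function.comp_def] using Set.range_comp_subset_range k.succAbove v
  have hcard (k : Fin (n + 4)) : (Finset.univ.image (v ∘ k.succAbove)).card = n + 3 :=
    (h.comp_strictMono (Fin.strictMono_succAbove k)).card_image
  exact h.convexPosition_range.insertionGraph_reachable_of_subset (hsub i) (hsub j) (hcard i)
    (hcard j)

variable {v : Fin 5 → Fin 2 → ℤ}

theorem strictMono_cross (h : IsConvexPolygon v) {u : Fin 2 → ℤ} (h₀ : 0 < cross (v 1 - v 0) u)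
    (h₃ : 0 < cross (v 4 - v 3) u) (hdiag : 0 < cross (v 3 - v 1) u) :
    StrictMono fun i => cross (v i) u := by
  have h₀₁₂ : 0 < orient (v 0) (v 1) (v 2) := h (by decide) (by decide)
  have h₀₁₃ : 0 < orient (v 0) (v 1) (v 3) := h (by decide) (by decide)
  have h₁₂₃ : 0 < orient (v 1) (v 2) (v 3) := h (by decide) (by decide)
  have h₁₃₄ : 0 < orient (v 1) (v 3) (v 4) := h (by decide) (by decide)
  have h₂₃₄ : 0 < orient (v 2) (v 3) (v 4) := h (by decide) (by decide)
  have h₁ : 0 < cross (v 2 - v 1) u := by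
    have hmul : orient (v 0) (v 1) (v 3) * cross (v 2 - v 1) u =
        orient (v 1) (v 2) (v 3) * cross (v 1 - v 0) u +
          orient (v 0) (v 1) (v 2) * cross (v 3 - v 1) u := by
      simp only [orient, cross, Pi.sub_apply]
      ring
    exact (mul_pos_iff_of_pos_left h₀₁₃).1 (hmul ▸ by positivity)
  have h₂ : 0 < cross (v 3 - v 2) u := by
    have hmul : orient (v 1) (v 3) (v 4) * cross (v 3 - v 2) u =
        orient (v 2) (v 3) (v 4) * cross (v 3 - v 1) u +
          orient (v 1) (v 2) (v 3) * cross (v 4 - v 3) u := by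
      simp only [orient, cross, Pi.sub_apply]
      ring
    exact (mul_pos_iff_of_pos_left h₁₃₄).1 (hmul ▸ by positivity)
  simp only [cross_sub_left, sub_pos] at h₀ h₁ h₂ h₃
  refine Fin.strictMono_iff_lt_succ.2 fun i => ?_
  fin_cases i
  exacts [h₀, h₁, h₂, h₃]

theorem convexChain_of_cross_neg (h : IsConvexPolygon v)
    (hneg : cross (v 4 - v 3) (v 1 - v 0) < 0) :
    ConvexChain ((v 4 - v 3) - (v 1 - v 0)) (Set.range v) := by
  have h₀₁₃ : 0 < orient (v 0) (v 1) (v 3) := h (by decide) (by decide)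
  have h₁₃₄ : 0 < orient (v 1) (v 3) (v 4) := h (by decide) (by decide)
  refine h.convexChain_range (h.strictMono_cross ?_ ?_ ?_)
  all_goals
    simp only [orient, cross, Pi.sub_apply] at *
    linarith

theorem reachesChain_of_edgeCross_neg (h : IsConvexPolygon v) {i : Fin 5}
    (hneg : edgeCross v i < 0) : ReachesChain 5 (Finset.univ.image v) := by
  wlog hi : i = 3 generalizing v i
  · refine .of_rotate (i - 3) (this (h.rotate (i - 3)) (i := 3) ?_ rfl)
    rwa [edgeCross_rotate, add_sub_cancel]
  subst hi
  exact ⟨_, _, .rfl, h.card_image, by simpa using h.convexChain_of_cross_neg hneg⟩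

theorem reachesChain_of_snoc {x : Fin 2 → ℤ}
    (h : IsConvexPolygon (Fin.snoc v x : Fin 6 → Fin 2 → ℤ)) {i : Fin 6} {j : Fin 5}
    (hneg : edgeCross ((Fin.snoc v x : Fin 6 → Fin 2 → ℤ) ∘ i.succAbove) j < 0) :
    ReachesChain 5 (Finset.univ.image v) := by
  have hreach := h.insertionGraph_reachable_succAbove (Fin.last _) i
  rw [Fin.succAbove_last, Fin.snoc_comp_castSucc] at hreach
  exact ((h.comp_strictMono (Fin.strictMono_succAbove i)).reachesChain_of_edgeCross_neg hneg)
    |>.of_reachable hreach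

theorem reachesChain_of_edgeCross_eq_zero (h : IsConvexPolygon v) {i : Fin 5}
    (hzero : edgeCross v i = 0) : ReachesChain 5 (Finset.univ.image v) := by
  wlog hi : i = 3 generalizing v i
  · refine .of_rotate (i - 3) (this (h.rotate (i - 3)) (i := 3) ?_ rfl)
    rwa [edgeCross_rotate, add_sub_cancel]
  subst hi
  have h₀₁₂ : 0 < orient (v 0) (v 1) (v 2) := h (by decide) (by decide)
  have h₂₃₄ : 0 < orient (v 2) (v 3) (v 4) := h (by decide) (by decide)
  have h₃₄₀ : 0 < orient (v 3) (v 4) (v 0) := by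
    rw [orient_rotate]
    exact h (by decide) (by decide)
  obtain ⟨k, hk, hk'⟩ : ∃ k : ℤ, orient (v 0) (v 2) (v 4) < orient (v 3) (v 4) (v 0) * k ∧
      orient (v 2) (v 3) (v 0) < orient (v 2) (v 3) (v 4) * k :=
    (((Filter.tendsto_id.const_mul_atTop' h₃₄₀).eventually_gt_atTop _).and
      ((Filter.tendsto_id.const_mul_atTop' h₂₃₄).eventually_gt_atTop _)).exists
  -- If `x` replaces `v 4`, the edges around the edge `v 3 x` diverge: the first one is unchanged,
  -- and the second one is nearly opposite to `v 4 - v 3`.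
  set x := v 2 + k • (v 4 - v 3) with hx
  have hprev : orient (v 3) (v 4) x = orient (v 2) (v 3) (v 4) := by
    simp only [hx, orient, cross, Pi.sub_apply, Pi.add_apply, Pi.smul_apply, smul_eq_mul]
    ring
  have hlast : orient (v 4) x (v 0) =
      orient (v 3) (v 4) (v 0) * k - orient (v 0) (v 2) (v 4) := by
    simp only [hx, orient, cross, Pi.sub_apply, Pi.add_apply, Pi.smul_apply, smul_eq_mul]
    ring
  have hfirst : orient x (v 0) (v 1) = orient (v 0) (v 1) (v 2) - k * edgeCross v 3 := by
    simp only [hx, orient, edgeCross, Fin.isValue, Fin.reduceAdd, cross, Pi.sub_apply,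
      Pi.add_apply, Pi.smul_apply, smul_eq_mul]
    ring
  have hneg : cross (v 3 - v 2) (v 0 - x) =
      orient (v 2) (v 3) (v 0) - orient (v 2) (v 3) (v 4) * k := by
    simp only [hx, orient, cross, Pi.sub_apply, Pi.add_apply, Pi.smul_apply, smul_eq_mul]
    ring
  rw [hzero, mul_zero, sub_zero] at hfirst
  have hsnoc : IsConvexPolygon (Fin.snoc v x : Fin 6 → Fin 2 → ℤ) :=
    h.snoc (h₂₃₄.trans_eq hprev.symm) ((sub_pos.2 hk).trans_eq hlast.symm)
      (h₀₁₂.trans_eq hfirst.symm)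
  exact hsnoc.reachesChain_of_snoc (i := 4) (j := 2) (hneg.trans_lt (sub_neg.2 hk'))

theorem reachesChain_of_ear_lt (h : IsConvexPolygon v) (hpos : ∀ j, 0 < edgeCross v j) {i : Fin 5}
    (hlt : ear v i < ear v (i + 1)) : ReachesChain 5 (Finset.univ.image v) := by
  wlog hi : i = 2 generalizing v i
  · refine .of_rotate (i - 2) (this (h.rotate (i - 2)) (fun j => ?_) (i := 2) ?_ rfl)
    · rw [edgeCross_rotate]
      exact hpos _
    · rwa [ear_rotate, ear_rotate, add_right_comm, add_sub_cancel]
  subst hi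
  -- The fourth vertex of the parallelogram on `v 0`, `v 2`, `v 3`.
  set x := v 0 + (v 3 - v 2) with hx
  have hprev : orient (v 3) (v 4) x = ear v (2 + 1) - ear v 2 := by
    simp only [hx, ear, orient, cross, Pi.sub_apply, Pi.add_apply, Fin.isValue, Fin.reduceAdd]
    ring
  have hlast : orient (v 4) x (v 0) = edgeCross v 2 := by
    simp only [hx, edgeCross, orient, cross, Pi.sub_apply, Pi.add_apply, Fin.isValue,
      Fin.reduceAdd]
    ring
  have hfirst : orient x (v 0) (v 1) = edgeCross v 0 := by
    simp only [hx, edgeCross, orient, cross, Pi.sub_apply, Pi.add_apply, Fin.isValue, zero_add]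
    ring
  have hneg : cross (v 1 - v 0) (v 4 - v 3) = -edgeCross v 3 := by
    simp only [edgeCross, cross, Pi.sub_apply, Fin.isValue, Fin.reduceAdd]
    ring
  have hsnoc : IsConvexPolygon (Fin.snoc v x : Fin 6 → Fin 2 → ℤ) :=
    h.snoc ((sub_pos.2 hlt).trans_eq hprev.symm) ((hpos 2).trans_eq hlast.symm)
      ((hpos 0).trans_eq hfirst.symm)
  exact hsnoc.reachesChain_of_snoc (i := 2) (j := 0) (hneg.trans_lt (neg_neg_of_pos (hpos 3)))

theorem reachesChain (h : IsConvexPolygon v) : ReachesChain 5 (Finset.univ.image v) := by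
  by_cases hpos : ∀ i, 0 < edgeCross v i
  · obtain ⟨i, hi⟩ := h.exists_ear_lt
    exact h.reachesChain_of_ear_lt hpos hi
  · push Not at hpos
    obtain ⟨i, hi⟩ := hpos
    rcases hi.lt_or_eq with hneg | hzero
    · exact h.reachesChain_of_edgeCross_neg hneg
    · exact h.reachesChain_of_edgeCross_eq_zero hzero

end IsConvexPolygon

theorem ConvexPosition.reachesChain {S : Finset (Fin 2 → ℤ)}
    (h : ConvexPosition (S : Set (Fin 2 → ℤ))) (hS : S.card = 5 ∨ S.card = 6) :
    ReachesChain 5 S := by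
  wlog hcard : S.card = 5 generalizing S
  · obtain ⟨x, hx⟩ : S.Nonempty := Finset.card_ne_zero.1 (by omega)
    have herase : (S.erase x).card = 5 := by rw [Finset.card_erase_of_mem hx]; omega
    have hadj := insertionGraph_adj_insert herase (S.notMem_erase x)
      (by rwa [← Finset.coe_insert, Finset.insert_erase hx])
    rw [Finset.insert_erase hx] at hadj
    exact (this (h.mono (Finset.coe_subset.2 (S.erase_subset x))) (.inl herase) herase)
      |>.of_reachable hadj.symm.reachable
  obtain ⟨v, hv, hvS⟩ := h.exists_isConvexPolygon hcard
  have hS' : Finset.univ.image v = S := by rw [← Finset.coe_inj]; simpa using hvS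
  exact hS' ▸ hv.reachesChain

end Pentagon

theorem theorem4 :
    ((latticePolytopeGraph 2).induce
      {P | P.1.vertices.ncard = 5 ∨ P.1.vertices.ncard = 6}).Connected := by
  refine SimpleGraph.connected_iff _ |>.2 ⟨fun P Q => ?_, ?_⟩
  · obtain ⟨S, hS, hPS⟩ := P.1.2.exists_finset_vertices_eq
    obtain ⟨T, hT, hQT⟩ := Q.1.2.exists_finset_vertices_eq
    have hScard : S.card = 5 ∨ S.card = 6 := FullPolytope.ncard_vertices hPS ▸ P.2
    have hTcard : T.card = 5 ∨ T.card = 6 := FullPolytope.ncard_vertices hQT ▸ Q.2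
    obtain ⟨S', u, hSS', hS', hu⟩ := hS.reachesChain hScard
    obtain ⟨T', u', hTT', hT', hu'⟩ := hT.reachesChain hTcard
    have hreach := hu.insertionGraph_reachable hu' hS' hT' (by simp)
    exact reachable_of_insertionGraph_reachable (by simp)
      (hSS'.trans (hreach.trans hTT'.symm)) hPS hQT
  · obtain ⟨S, hS, hchain, -⟩ :=
      exists_convexChain_card_eq (w := ![1, 0]) (u := ![0, 1]) (by simp [cross]) 5
    obtain ⟨P, hP, hPS⟩ := hchain.convexPosition.exists_vertices_eq (by omega)
    exact ⟨⟨P, hP⟩, .inl ((FullPolytope.ncard_vertices hPS).trans hS)⟩
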